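/- Let $K$ be a field of characteristic zero and let $\mathrm{NSym}=K\langle H_1,H_2,\dots\rangle$ be the free associative algebra on noncommuting generators $H_i$ ($i\ge 1$); put $H_0=1$ and $H_a=0$ for $a<0$, and $H_\beta=H_{\beta_1}\cdots H_{\beta_m}$ for a composition (finite sequence of positive integers) $\beta=(\beta_1,\dots,\beta_m)$. Let $\mathrm{QSym}$ be the algebra of quasisymmetric functions over $K$ with monomial basis $M_\beta$, paired with $\mathrm{NSym}$ by $\langle M_\beta,H_\gamma\rangle=\delta_{\beta,\gamma}$. Let $F_\beta$ be the fundamental quasisymmetric function, the sum of $M_\gamma$ over all compositions $\gamma$ refining $\beta$, and for $f\in\mathrm{QSym}$ let $f^\perp$ be the linear endomorphism of $\mathrm{NSym}$ adjoint to multiplication by $f$. For $m\in\mathbb Z$ let $\mathbb B_m=\sum_{i\ge 0}(-1)^iH_{m+i}F_{1^i}^\perp$ be the noncommutative Bernstein operator, and define the immaculate function $\mathfrak S_\mu=\mathbb B_{\mu_1}\cdots\mathbb B_{\mu_k}(1)$ for $\mu\in\mathbb Z^k$. For a composition $\beta$ with $\ell(\beta)$ parts, the ribbon function is $R_\beta=\sum_{\gamma}(-1)^{\ell(\gamma)-\ell(\beta)}H_\gamma$,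 summed over all coarsenings $\gamma$ of $\beta$ (compositions obtained by adding up blocks of consecutive parts of $\beta$); put $R_\beta=0$ if $\beta$ is an integer sequence with a nonpositive part. **Theorem.** Let $\alpha=(\alpha_1,\dots,\alpha_k)$ be a composition of positive integers for which there exists $J$ with $1\le J\le k$ such that $\alpha_\ell\ge \ell$ for $1\le\ell\le J$ and $\alpha_\ell=J$ for $J+1\le\ell\le k$. Then $$\mathfrak S_\alpha=\sum_{\sigma\in S_k}\varepsilon(\sigma)\,R_{(\alpha_1-1+\sigma_1,\ \alpha_2-2+\sigma_2,\ \dots,\ \alpha_k-k+\sigma_k)},$$ where $\varepsilon(\sigma)$ is the sign of $\sigma$ and $\sigma_\ell=\sigma(\ell)$. -/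

import Mathlib

open Finset (range)

noncomputable section

namespace Immaculate

/-! ### Quasisymmetric functions, as formal power series in `x₀, x₁, x₂, …` -/

/-- The exponent of the monomial `x_{j_1}^{a_1} ⋯ x_{j_k}^{a_k}`. -/
def expo {k : ℕ} (j : Fin k → ℕ) (a : Fin k → ℕ) : ℕ →₀ ℕ :=
  ∑ i, Finsupp.single (j i) (a i)

/-- `e` is the exponent of a monomial `x_{j_1}^{α_1} ⋯ x_{j_k}^{α_k}` with `j_1 < ⋯ < j_k`. -/
def HasShape {n : ℕ} (α : Composition n) (e : ℕ →₀ ℕ) : Prop :=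
  ∃ j : Fin α.length → ℕ, StrictMono j ∧ e = expo j α.blocksFun

/-- A quasisymmetric function over `K`: a power series of bounded degree in which, for each
composition `α`, all the monomials `x_{j_1}^{α_1} ⋯ x_{j_k}^{α_k}` with `j_1 < ⋯ < j_k` have the
same coefficient. -/
def IsQSym {K : Type*} [Field K] (f : MvPowerSeries ℕ K) : Prop :=
  (∃ N : ℕ, ∀ e : ℕ →₀ ℕ, N < e.degree → MvPowerSeries.coeff e f = 0) ∧
  ∀ (n : ℕ) (α : Composition n) (j : Fin α.length → ℕ), StrictMono j →
    MvPowerSeries.coeff (expo j α.blocksFun) f =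
      MvPowerSeries.coeff (expo (fun i => (i : ℕ)) α.blocksFun) f

open scoped Classical in
/-- The monomial quasisymmetric function
`M_α = ∑_{j_1 < ⋯ < j_k} x_{j_1}^{α_1} ⋯ x_{j_k}^{α_k}`. As all parts of `α` are positive, different
sequences `j` give different monomials. -/
def monomialQSym (K : Type*) [Field K] {n : ℕ} (α : Composition n) : MvPowerSeries ℕ K :=
  fun e => if HasShape α e then 1 else 0

/-- `β` is a coarsening of `α` (written `β ⪰ α`): its parts are obtained from those of `α` by adding
up the parts in blocks of consecutive ones. -/
def Coarsens {n : ℕ} (β α : Composition n) : Prop :=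
  ∃ c : Composition α.length, α.gather c = β

open scoped Classical in
/-- The fundamental quasisymmetric function `F_α`, the sum of the `M_β` over all refinements `β`
of `α`. -/
def fundamentalQSym (K : Type*) [Field K] {n : ℕ} (α : Composition n) : MvPowerSeries ℕ K :=
  ∑ β : Composition n with Coarsens α β, monomialQSym K β

/-! ### Noncommutative symmetric functions -/

/-- `NSym` is the free associative algebra on generators `H_1, H_2, …`. -/
abbrev NSym (K : Type*) [Field K] : Type _ := FreeAlgebra K ℕ+

/-- `H_a` for an integer `a`, with `H_0 = 1` and `H_a = 0` for `a < 0`. -/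
def H (K : Type*) [Field K] (a : ℤ) : NSym K :=
  if h : 0 < a then FreeAlgebra.ι K (⟨a.toNat, by omega⟩ : ℕ+) else if a = 0 then 1 else 0

/-- `H_α = H_{α_1} ⋯ H_{α_k}` for a composition `α`. -/
def HComp (K : Type*) [Field K] {n : ℕ} (α : Composition n) : NSym K :=
  (α.blocks.map fun i : ℕ => H K (i : ℤ)).prod

/-- The basis of `NSym` formed by the products `H_{w_1} ⋯ H_{w_k}`, `w_i ≥ 1`. -/
abbrev wordBasis (K : Type*) [Field K] : Module.Basis (FreeMonoid ℕ+) K (NSym K) :=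
  FreeAlgebra.basisFreeMonoid K ℕ+

/-- The degree `w_1 + ⋯ + w_k` of the basis element `H_{w_1} ⋯ H_{w_k}`. -/
def wordSize (w : FreeMonoid ℕ+) : ℕ := (w.toList.map fun i : ℕ+ => (i : ℕ)).sum

/-- The parts of a word, seen as a composition. -/
def wordComp (w : FreeMonoid ℕ+) : Composition (wordSize w) where
  blocks := w.toList.map fun i : ℕ+ => (i : ℕ)
  blocks_pos := by
    intro i hi
    obtain ⟨p, -, rfl⟩ := List.mem_map.1 hi
    exact p.pos
  blocks_sum := rfl

/-- The pairing between quasisymmetric functions and `NSym` for which `M` and `H` are dual bases: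
`⟨f, H_α⟩` is the coefficient of `M_α` in `f`, which is the coefficient of
`x_0^{α_1} ⋯ x_{k-1}^{α_k}`. -/
def pairing {K : Type*} [Field K] (f : MvPowerSeries ℕ K) : NSym K →ₗ[K] K :=
  (wordBasis K).constr K fun w =>
    MvPowerSeries.coeff (expo (fun i => (i : ℕ)) (wordComp w).blocksFun) f

/-- The linear map `f^⊥` of `NSym` adjoint to multiplication by `f`:
`f^⊥ H_w = ∑_α ⟨f M_α, H_w⟩ H_α`. (Compositions `α` of numbers larger than the size of `w`
contribute nothing.) It is the unique adjoint, see `pairing_perp` and `eq_perp`. -/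
def perp {K : Type*} [Field K] (f : MvPowerSeries ℕ K) : NSym K →ₗ[K] NSym K :=
  (wordBasis K).constr K fun w =>
    ∑ n ∈ range (wordSize w + 1), ∑ α : Composition n,
      pairing (f * monomialQSym K α) (wordBasis K w) • HComp K α

/-! #### The map `perp f` is the adjoint of multiplication by `f` -/

theorem sort_map_expo {k : ℕ} {j a : Fin k → ℕ} (hj : StrictMono j) (ha : ∀ i, 0 < a i) :
    ((expo j a).support.sort (· ≤ ·)).map (expo j a) = List.ofFn a := by
  have hval : ∀ i, expo j a (j i) = a i := by
    intro i
    simp [expo, Finsupp.finsetSum_apply, Finsupp.single_apply, hj.injective.eq_iff]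
  have hsupp : (expo j a).support = (List.ofFn j).toFinset := by
    ext x
    simp only [Finsupp.mem_support_iff, List.mem_toFinset, List.mem_ofFn]
    constructor
    · intro hx
      by_contra hne
      apply hx
      simp only [expo, Finsupp.finsetSum_apply]
      refine Finset.sum_eq_zero fun i _ => ?_
      rw [Finsupp.single_apply, if_neg]
      exact fun h => hne ⟨i, h⟩
    · rintro ⟨i, rfl⟩
      rw [hval]
      exact (ha i).ne'
  rw [hsupp, (List.toFinset_sort (· ≤ ·) (List.nodup_ofFn.2 hj.injective)).2
    (List.pairwise_ofFn.2 fun _ _ h => (hj h).le), List.map_ofFn]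
  congr 1
  funext i
  exact hval i

theorem blocksFun_pos {n : ℕ} (α : Composition n) (i : Fin α.length) : 0 < α.blocksFun i :=
  α.one_le_blocksFun i

theorem degree_expo {k : ℕ} (j a : Fin k → ℕ) : (expo j a).degree = ∑ i, a i := by
  simp [expo, map_sum]

theorem HasShape.degree_eq {n : ℕ} {α : Composition n} {e : ℕ →₀ ℕ} (h : HasShape α e) :
    e.degree = n := by
  obtain ⟨j, -, rfl⟩ := h
  rw [degree_expo, α.sum_blocksFun]

theorem HasShape.unique {n : ℕ} {α β : Composition n} {e : ℕ →₀ ℕ} (h : HasShape α e)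
    (h' : HasShape β e) : α = β := by
  obtain ⟨j, hj, rfl⟩ := h
  obtain ⟨j', hj', he⟩ := h'
  have h1 := sort_map_expo hj (blocksFun_pos α)
  have h2 := sort_map_expo hj' (blocksFun_pos β)
  rw [← he, h1, α.ofFn_blocksFun, β.ofFn_blocksFun] at h2
  exact Composition.ext h2

theorem exists_hasShape (e : ℕ →₀ ℕ) : ∃ α : Composition e.degree, HasShape α e := by
  have hs : (List.ofFn fun i : Fin e.support.card => e (e.support.orderEmbOfFin rfl i)).sum
      = e.degree := by
    rw [List.sum_ofFn, Finsupp.degree_apply]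
    rw [← Finset.sum_coe_sort e.support]
    exact Fintype.sum_equiv (e.support.orderIsoOfFin rfl).toEquiv _ _ fun i => rfl
  let α : Composition e.degree :=
    ⟨List.ofFn fun i : Fin e.support.card => e (e.support.orderEmbOfFin rfl i), by
      intro i hi
      obtain ⟨p, rfl⟩ := List.mem_ofFn.1 hi
      exact Nat.pos_of_ne_zero (Finsupp.mem_support_iff.1 (Finset.orderEmbOfFin_mem _ _ _)), hs⟩
  have hl : α.length = e.support.card := by simp [α, Composition.length]
  refine ⟨α, fun i => e.support.orderEmbOfFin rfl (Fin.cast hl i), ?_, ?_⟩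
  · intro a b hab
    exact (e.support.orderEmbOfFin rfl).strictMono (by simpa using hab)
  · have hb : ∀ i, α.blocksFun i = e (e.support.orderEmbOfFin rfl (Fin.cast hl i)) := by
      intro i
      simp [α, Composition.blocksFun]
      rfl
    simp only [expo, hb]
    rw [Fintype.sum_equiv (finCongr hl) (fun i => Finsupp.single (e.support.orderEmbOfFin rfl
      (Fin.cast hl i)) (e (e.support.orderEmbOfFin rfl (Fin.cast hl i)))) (fun i => Finsupp.single (e.support.orderEmbOfFin rfl i)
      (e (e.support.orderEmbOfFin rfl i))) fun i => rfl]
    rw [Fintype.sum_equiv (e.support.orderIsoOfFin rfl).toEquiv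
      (fun i => Finsupp.single (e.support.orderEmbOfFin rfl i) (e (e.support.orderEmbOfFin rfl i)))
      (fun x : e.support => Finsupp.single (x : ℕ) (e x)) fun i => rfl]
    rw [Finset.sum_coe_sort e.support (fun x => Finsupp.single x (e x))]
    exact (Finsupp.sum_single e).symm

variable {K : Type*} [Field K]

theorem coeff_monomialQSym {n : ℕ} (α : Composition n) (e : ℕ →₀ ℕ) [Decidable (HasShape α e)] :
    MvPowerSeries.coeff e (monomialQSym K α) = if HasShape α e then 1 else 0 := by
  simp only [MvPowerSeries.coeff_apply, monomialQSym]
  congr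

theorem hasShape_self {n : ℕ} (α : Composition n) :
    HasShape α (expo (fun i => (i : ℕ)) α.blocksFun) :=
  ⟨_, fun _ _ h => h, rfl⟩

theorem isQSym_monomialQSym {n : ℕ} (α : Composition n) : IsQSym (monomialQSym K α) := by
  classical
  refine ⟨⟨n, fun e he => ?_⟩, fun m β j hj => ?_⟩
  · rw [coeff_monomialQSym, if_neg]
    exact fun h => he.ne' h.degree_eq
  · rw [coeff_monomialQSym, coeff_monomialQSym]
    have key : ∀ i : Fin β.length → ℕ, StrictMono i →
        (HasShape α (expo i β.blocksFun) ↔ α.blocks = β.blocks) := by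
      intro i hi
      constructor
      · rintro ⟨j', hj', he⟩
        have h1 := sort_map_expo hi (blocksFun_pos β)
        have h2 := sort_map_expo hj' (blocksFun_pos α)
        rw [← he, h1, α.ofFn_blocksFun, β.ofFn_blocksFun] at h2
        exact h2.symm
      · intro hb
        have hmn : m = n := by rw [← α.blocks_sum, ← β.blocks_sum, hb]
        subst hmn
        obtain rfl : α = β := Composition.ext hb
        exact ⟨i, hi, rfl⟩
    simp only [key j hj, key (fun i => (i : ℕ)) fun _ _ h => h]

theorem wordBasis_apply (w : FreeMonoid ℕ+) :
    wordBasis K w = (w.toList.map fun i : ℕ+ => FreeAlgebra.ι K i).prod := by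
  simp [wordBasis, FreeAlgebra.basisFreeMonoid, FreeAlgebra.equivMonoidAlgebraFreeMonoid,
    FreeMonoid.lift_apply]

theorem H_coe (i : ℕ+) : H K ((i : ℕ) : ℤ) = FreeAlgebra.ι K i := by
  have : (0 : ℤ) < ((i : ℕ) : ℤ) := by exact_mod_cast i.pos
  rw [H, dif_pos this]
  congr 1

theorem wordBasis_eq_HComp (w : FreeMonoid ℕ+) : wordBasis K w = HComp K (wordComp w) := by
  rw [wordBasis_apply, HComp, wordComp, List.map_map]
  congr 2
  funext i
  exact (H_coe i).symm

/-- The word with the parts of a given composition. -/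
def compWord {n : ℕ} (α : Composition n) : FreeMonoid ℕ+ :=
  FreeMonoid.ofList (α.blocks.pmap (fun i hi => Nat.toPNat i hi) fun _ hi => α.blocks_pos hi)

theorem compWord_map {n : ℕ} (α : Composition n) :
    ((compWord α).toList.map fun i : ℕ+ => (i : ℕ)) = α.blocks := by
  rw [compWord, FreeMonoid.toList_ofList, List.map_pmap]
  exact (List.pmap_eq_map (f := fun i : ℕ => i) _).trans (List.map_id _)

theorem HComp_eq_wordBasis {n : ℕ} (α : Composition n) : HComp K α = wordBasis K (compWord α) := by
  rw [wordBasis_eq_HComp, HComp, HComp]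
  congr 2
  exact (compWord_map α).symm

theorem pairing_wordBasis (f : MvPowerSeries ℕ K) (w : FreeMonoid ℕ+) :
    pairing f (wordBasis K w) =
      MvPowerSeries.coeff (expo (fun i => (i : ℕ)) (wordComp w).blocksFun) f :=
  (wordBasis K).constr_basis K _ w

theorem perp_wordBasis (f : MvPowerSeries ℕ K) (w : FreeMonoid ℕ+) :
    perp f (wordBasis K w) = ∑ n ∈ range (wordSize w + 1), ∑ α : Composition n,
      pairing (f * monomialQSym K α) (wordBasis K w) • HComp K α :=
  (wordBasis K).constr_basis K _ w

/-- `⟨f, H_α⟩` is the coefficient of `x_0^{α_1} ⋯ x_{k-1}^{α_k}`. -/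
theorem pairing_HComp (f : MvPowerSeries ℕ K) {n : ℕ} (α : Composition n) :
    pairing f (HComp K α) =
      MvPowerSeries.coeff (expo (fun i => (i : ℕ)) α.blocksFun) f := by
  rw [HComp_eq_wordBasis, pairing_wordBasis]
  have h := compWord_map α
  have hn : wordSize (compWord α) = n := by rw [wordSize, h, α.blocks_sum]
  have : ∀ (m : ℕ) (β : Composition m), m = n → β.blocks = α.blocks →
      expo (fun i => (i : ℕ)) β.blocksFun = expo (fun i => (i : ℕ)) α.blocksFun := by
    rintro m β rfl hb
    rw [Composition.ext hb]
  rw [this _ (wordComp (compWord α)) hn h]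

/-- The monomial and the complete homogeneous basis are dual. -/
theorem pairing_monomialQSym {n : ℕ} (α β : Composition n) :
    pairing (monomialQSym K α) (HComp K β) = if α = β then 1 else 0 := by
  classical
  rw [pairing_HComp, coeff_monomialQSym]
  refine if_congr ⟨fun h => h.unique (hasShape_self β), ?_⟩ rfl rfl
  rintro rfl
  exact hasShape_self α

theorem coeff_eq_sum {g : MvPowerSeries ℕ K} (hg : IsQSym g) (e : ℕ →₀ ℕ) {N : ℕ}
    (he : e.degree ≤ N) :
    MvPowerSeries.coeff e g = ∑ n ∈ range (N + 1), ∑ α : Composition n,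
      pairing g (HComp K α) * MvPowerSeries.coeff e (monomialQSym K α) := by
  classical
  obtain ⟨α, hα⟩ := exists_hasShape e
  rw [Finset.sum_eq_single_of_mem e.degree (by simpa [Nat.lt_succ_iff] using he),
    Finset.sum_eq_single_of_mem α (Finset.mem_univ _)]
  · rw [coeff_monomialQSym, if_pos hα, mul_one, pairing_HComp]
    obtain ⟨j, hj, hje⟩ := id hα
    rw [← hg.2 _ α j hj, ← hje]
  · intro β _ hβ
    rw [coeff_monomialQSym, if_neg, mul_zero]
    exact fun h => hβ (h.unique hα)
  · intro n _ hn
    refine Finset.sum_eq_zero fun β _ => ?_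
    rw [coeff_monomialQSym, if_neg, mul_zero]
    exact fun h => hn h.degree_eq.symm

/-- `perp f` is adjoint to multiplication by `f` on quasisymmetric functions. -/
theorem pairing_perp (f : MvPowerSeries ℕ K) {g : MvPowerSeries ℕ K} (hg : IsQSym g)
    (h : NSym K) : pairing (f * g) h = pairing g (perp f h) := by
  classical
  have : pairing (f * g) = pairing g ∘ₗ perp f := by
    refine (wordBasis K).ext fun w => ?_
    rw [LinearMap.comp_apply, perp_wordBasis]
    simp only [map_sum, map_smul, smul_eq_mul, pairing_wordBasis, MvPowerSeries.coeff_mul]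
    have hle : ∀ p ∈ Finset.HasAntidiagonal.antidiagonal (expo (fun i => (i : ℕ)) (wordComp w).blocksFun),
        p.2.degree ≤ wordSize w := by
      intro p hp
      have h1 := congrArg Finsupp.degree (Finset.HasAntidiagonal.mem_antidiagonal.1 hp)
      rw [degree_expo, Composition.sum_blocksFun, map_add] at h1
      omega
    rw [Finset.sum_congr rfl fun p hp => by rw [coeff_eq_sum hg p.2 (hle p hp)]]
    simp only [Finset.mul_sum, Finset.sum_mul]
    rw [Finset.sum_comm]
    refine Finset.sum_congr rfl fun n _ => ?_
    rw [Finset.sum_comm]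
    refine Finset.sum_congr rfl fun α _ => Finset.sum_congr rfl fun p _ => ?_
    ring
  exact LinearMap.congr_fun this h

/-- A linear map that is adjoint to multiplication by `f` is `perp f`. -/
theorem eq_perp (f : MvPowerSeries ℕ K) (T : NSym K →ₗ[K] NSym K)
    (hT : ∀ g : MvPowerSeries ℕ K, IsQSym g → ∀ h : NSym K,
      pairing (f * g) h = pairing g (T h)) : T = perp f := by
  classical
  have hcoord : ∀ (w : FreeMonoid ℕ+),
      pairing (monomialQSym K (wordComp w)) = (wordBasis K).coord w := by
    intro w
    refine (wordBasis K).ext fun v => ?_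
    rw [pairing_wordBasis, coeff_monomialQSym, Module.Basis.coord_apply,
      Module.Basis.repr_self, Finsupp.single_apply]
    refine if_congr ⟨?_, ?_⟩ rfl rfl
    · rintro ⟨j, hj, he⟩
      have h1 := sort_map_expo (j := fun i : Fin (wordComp v).length => (i : ℕ))
        (fun _ _ h => h) (blocksFun_pos (wordComp v))
      have h2 := sort_map_expo hj (blocksFun_pos (wordComp w))
      rw [← he, h1, Composition.ofFn_blocksFun, Composition.ofFn_blocksFun] at h2
      exact FreeMonoid.toList.injective (List.map_injective_iff.2 PNat.coe_injective h2)
    · rintro rfl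
      exact hasShape_self _
  refine LinearMap.ext fun h => (wordBasis K).ext_elem fun w => ?_
  have := (hT _ (isQSym_monomialQSym (wordComp w)) h).symm.trans
    (pairing_perp f (isQSym_monomialQSym (wordComp w)) h)
  rw [hcoord] at this
  exact this

theorem coeff_fundamentalQSym_mul {i : ℕ} (γ : Composition i) (f : MvPowerSeries ℕ K)
    {e : ℕ →₀ ℕ} (he : e.degree < i) :
    MvPowerSeries.coeff e (fundamentalQSym K γ * f) = 0 := by
  classical
  rw [MvPowerSeries.coeff_mul]
  refine Finset.sum_eq_zero fun p hp => ?_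
  rw [fundamentalQSym, map_sum, Finset.sum_eq_zero, zero_mul]
  intro β _
  rw [coeff_monomialQSym, if_neg]
  intro h
  have h1 := congrArg Finsupp.degree (Finset.HasAntidiagonal.mem_antidiagonal.1 hp)
  rw [map_add, h.degree_eq] at h1
  omega

/-- For each `h` only finitely many of the `F_{1^i}^⊥ h` are nonzero. -/
theorem finite_support_perp (h : NSym K) :
    {i : ℕ | perp (fundamentalQSym K (Composition.ones i)) h ≠ 0}.Finite := by
  induction (wordBasis K).mem_span h using Submodule.span_induction with
  | zero => simp
  | add x y _ _ hx hy =>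
    refine (hx.union hy).subset fun i hi => ?_
    by_contra hne
    simp only [Set.mem_union, Set.mem_ofPred_eq, not_or, not_not] at hne
    exact hi (by rw [map_add, hne.1, hne.2, add_zero])
  | smul c x _ hx =>
    refine hx.subset fun i hi h0 => ?_
    exact hi (by rw [map_smul, h0, smul_zero])
  | mem x hx =>
    obtain ⟨w, rfl⟩ := hx
    refine (Set.finite_Iic (wordSize w)).subset fun i hi => ?_
    by_contra hlt
    apply hi
    rw [perp_wordBasis]
    refine Finset.sum_eq_zero fun n _ => Finset.sum_eq_zero fun α _ => ?_
    rw [pairing_wordBasis, coeff_fundamentalQSym_mul, zero_smul]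
    rw [degree_expo, Composition.sum_blocksFun]
    exact not_le.1 hlt

theorem finite_support_bernstein (m : ℤ) (h : NSym K) :
    (Function.support fun i : ℕ =>
      (-1 : NSym K) ^ i * H K (m + i) * perp (fundamentalQSym K (Composition.ones i)) h).Finite :=
  (finite_support_perp h).subset fun i hi h0 => hi (by
    show (-1 : NSym K) ^ i * H K (m + i) * perp (fundamentalQSym K (Composition.ones i)) h = 0
    rw [h0, mul_zero])

/-! ### Immaculate functions and ribbons -/

/-- The noncommutative Bernstein operator `𝔹_m = ∑_{i ≥ 0} (-1)^i H_{m+i} F_{1^i}^⊥`. -/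
def bernstein (K : Type*) [Field K] (m : ℤ) : NSym K →ₗ[K] NSym K where
  toFun h := ∑ᶠ i : ℕ,
    (-1 : NSym K) ^ i * H K (m + i) * perp (fundamentalQSym K (Composition.ones i)) h
  map_add' x y := by
    rw [← finsum_add_distrib (finite_support_bernstein m x) (finite_support_bernstein m y)]
    simp only [map_add, mul_add]
  map_smul' c x := by
    rw [RingHom.id_apply, smul_finsum' c (finite_support_bernstein m x)]
    simp only [map_smul, mul_smul_comm]

/-- The immaculate function `𝔖_μ = 𝔹_{μ_1} ⋯ 𝔹_{μ_k}(1)` of an integer sequence `μ`. -/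
def immaculate (K : Type*) [Field K] (μ : List ℤ) : NSym K :=
  μ.foldr (fun m h => bernstein K m h) 1

open scoped Classical in
/-- The ribbon `R_α = ∑_{β ⪰ α} (-1)^{ℓ(β) - ℓ(α)} H_β` of a composition `α`, the sum being over
the coarsenings `β` of `α`. (The exponent is written `ℓ(α) - ℓ(β)`, which is nonnegative.) -/
def ribbonComp (K : Type*) [Field K] {n : ℕ} (α : Composition n) : NSym K :=
  ∑ β : Composition n with Coarsens β α, (-1 : NSym K) ^ (α.length - β.length) * HComp K β

/-- The composition with parts `b_1, …, b_k`, for positive integers `b_i`. -/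
def compOfPos {k : ℕ} (b : Fin k → ℤ) (hb : ∀ i, 0 < b i) :
    Composition (List.ofFn fun i => (b i).toNat).sum where
  blocks := List.ofFn fun i => (b i).toNat
  blocks_pos := by
    intro i hi
    obtain ⟨p, rfl⟩ := List.mem_ofFn.1 hi
    have := hb p
    omega
  blocks_sum := rfl

open scoped Classical in
/-- The ribbon of an integer sequence, with the convention that it vanishes if the sequence has a
nonpositive part. -/
def ribbon (K : Type*) [Field K] {k : ℕ} (b : Fin k → ℤ) : NSym K :=
  if hb : ∀ i, 0 < b i then ribbonComp K (compOfPos b hb) else 0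

end Immaculate

end

noncomputable section

namespace Immaculate

variable {K : Type*} [Field K]

/-! ### Ribbons by recursion on lists -/

/-! The argument compares two signed sums over permutations, one of products of generators and one
of ribbons. The first comes from a Jacobi–Trudi formula (`immaculate_eq_sum_perm`), valid for every
integer sequence. Since `F_{1^i}^⊥` lowers by one the indices of `i` factors of a product of
generators, encoding `H_{b_1} ⋯ H_{b_k}` as the Laurent monomial `x^b` turns `𝔹_m` into
multiplication by `x_0^m ∏_j (1 - x_0/x_j)`. The commutative variables record positions, so the
noncommutativity of `NSym` is harmless. Iterating gives `x^a ∏_{i<j} (1 - x_i/x_j)`, a Vandermonde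
determinant up to a monomial. The passage to ribbons converts the factors one at a time, from the
left, with the rule `R_{(l,a)} H_b = R_{(l,a,b)} + R_{(l,a+b)}` (`ribbonList_append_mul`). With the
vanishing conventions for nonpositive entries, each conversion leaves a merged term that depends on
two adjacent entries only through their sum and a sign condition (`partialRibbon_succ`). Exchanging
two adjacent values of `σ` preserves the sum. The hypotheses on `α` make the sign condition
invariant too, so the merged terms cancel in pairs (`sum_mergedRibbon_eq_zero`). -/

/-- The ribbon of a list of integers, by expanding along the first entry. -/
def ribbonList (K : Type*) [Field K] : List ℤ → NSym K
  | [] => 1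
  | [a] => H K a
  | a :: b :: l => H K a * ribbonList K (b :: l) - ribbonList K ((a + b) :: l)
termination_by l => l.length

/-- The lists obtained by adding up blocks of consecutive entries of a list. -/
def coarsenings : List ℕ → Finset (List ℕ)
  | [] => {[]}
  | [a] => {[a]}
  | a :: b :: l => (coarsenings (b :: l)).image (List.cons a) ∪ coarsenings ((a + b) :: l)
termination_by l => l.length

/-- The two branches of the recursion separate the case where the first block is `[a]` alone from
the case where it also contains `b`. In the latter, `a` and `b` can be added up beforehand. -/
theorem mem_coarsenings (l m : List ℕ) :
    m ∈ coarsenings l ↔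
      ∃ L : List (List ℕ), (∀ x ∈ L, x ≠ []) ∧ L.flatten = l ∧ L.map List.sum = m := by
  induction l using coarsenings.induct generalizing m with
  | case1 =>
    simp only [coarsenings, Finset.mem_singleton]
    constructor
    · rintro rfl
      exact ⟨[], by simp⟩
    · rintro ⟨L, h1, h2, rfl⟩
      rcases L with _ | ⟨x, L⟩
      · rfl
      · simp at h2 h1
        exact absurd h2.1 h1.1
  | case2 a =>
    simp only [coarsenings, Finset.mem_singleton]
    constructor
    · rintro rfl
      exact ⟨[[a]], by simp⟩
    · rintro ⟨L, h1, h2, rfl⟩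
      rcases L with _ | ⟨_ | ⟨x, y⟩, L⟩
      · simp at h2
      · simp at h1
      · simp only [List.flatten_cons, List.cons_append, List.cons.injEq,
          List.append_eq_nil_iff] at h2
        obtain ⟨rfl, rfl, h3⟩ := h2
        rcases L with _ | ⟨z, L⟩
        · simp
        · simp at h1 h3
          exact absurd h3.1 h1.1
  | case3 a b l ih1 ih2 =>
    rw [coarsenings, Finset.mem_union, Finset.mem_image, ih2]
    simp only [ih1]
    constructor
    · rintro (⟨m, ⟨L, h1, h2, rfl⟩, rfl⟩ | ⟨L, h1, h2, rfl⟩)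
      · exact ⟨[a] :: L, by simpa using h1, by simp [h2], by simp⟩
      · rcases L with _ | ⟨_ | ⟨x, y⟩, L⟩
        · simp at h2
        · simp at h1
        · simp only [List.flatten_cons, List.cons_append, List.cons.injEq] at h2
          obtain ⟨rfl, rfl⟩ := h2
          refine ⟨(a :: b :: y) :: L, ?_, by simp, by simp [add_assoc]⟩
          simpa using h1
    · rintro ⟨L, h1, h2, rfl⟩
      rcases L with _ | ⟨_ | ⟨x, _ | ⟨z, y⟩⟩, L⟩
      · simp at h2
      · simp at h1
      · left
        simp only [List.flatten_cons, List.cons_append, List.cons.injEq, List.nil_append] at h2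
        obtain ⟨rfl, h2⟩ := h2
        exact ⟨_, ⟨L, fun x hx => h1 x (by simp [hx]), h2, rfl⟩, by simp⟩
      · right
        simp only [List.flatten_cons, List.cons_append, List.cons.injEq] at h2
        obtain ⟨rfl, rfl, rfl⟩ := h2
        refine ⟨((x + z) :: y) :: L, ?_, by simp, by simp [add_assoc]⟩
        simpa using h1

theorem coarsens_iff {n : ℕ} (β α : Composition n) :
    Coarsens β α ↔ β.blocks ∈ coarsenings α.blocks := by
  rw [mem_coarsenings]
  constructor
  · rintro ⟨c, rfl⟩
    refine ⟨α.blocks.splitWrtComposition c, fun x hx => ?_,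
      List.flatten_splitWrtComposition _ _, rfl⟩
    exact List.length_pos_iff.1 (List.length_pos_of_mem_splitWrtComposition hx)
  · rintro ⟨L, h1, h2, h3⟩
    obtain ⟨l, hl, hs⟩ := α
    simp only at h2
    subst h2
    refine ⟨⟨L.map List.length, ?_, by rw [← List.length_flatten]⟩, ?_⟩
    · intro i hi
      obtain ⟨x, hx, rfl⟩ := List.mem_map.1 hi
      exact List.length_pos_iff.2 (h1 x hx)
    · apply Composition.ext
      rw [← h3]
      change List.map List.sum (List.splitWrtComposition L.flatten _) = _
      exact congrArg _ (List.splitWrtComposition_flatten L _ rfl)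

theorem sum_of_mem_coarsenings {l m : List ℕ} (h : m ∈ coarsenings l) : m.sum = l.sum := by
  obtain ⟨L, -, rfl, rfl⟩ := (mem_coarsenings l m).1 h
  exact List.sum_flatten.symm

theorem pos_of_mem_coarsenings {l m : List ℕ} (h : m ∈ coarsenings l) (hl : ∀ i ∈ l, 0 < i) :
    ∀ i ∈ m, 0 < i := by
  obtain ⟨L, h1, rfl, rfl⟩ := (mem_coarsenings l m).1 h
  intro i hi
  obtain ⟨x, hx, rfl⟩ := List.mem_map.1 hi
  exact List.sum_pos _ (fun y hy => hl y (List.mem_flatten.2 ⟨x, hx, hy⟩)) (h1 x hx)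

theorem length_of_mem_coarsenings {l m : List ℕ} (h : m ∈ coarsenings l) :
    m.length ≤ l.length := by
  induction l using coarsenings.induct generalizing m with
  | case1 => simp_all [coarsenings]
  | case2 a => simp_all [coarsenings]
  | case3 a b l ih1 ih2 =>
    rw [coarsenings, Finset.mem_union, Finset.mem_image] at h
    rcases h with ⟨m, hm, rfl⟩ | h
    · simpa using ih1 hm
    · exact (ih2 h).trans (by simp)

theorem head_of_mem_coarsenings {a : ℕ} {l m : List ℕ} (h : m ∈ coarsenings (a :: l)) :
    ∃ c m', m = c :: m' ∧ a ≤ c := by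
  obtain ⟨L, h1, h2, rfl⟩ := (mem_coarsenings _ m).1 h
  rcases L with _ | ⟨_ | ⟨x, y⟩, L⟩
  · simp at h2
  · simp at h1
  · simp only [List.flatten_cons, List.cons_append, List.cons.injEq] at h2
    exact ⟨_, _, List.map_cons, by simp [h2.1]⟩

theorem ribbonList_eq_sum (l : List ℕ) (hl : ∀ i ∈ l, 0 < i) :
    ribbonList K (l.map fun i : ℕ => (i : ℤ)) = ∑ m ∈ coarsenings l,
      (-1 : NSym K) ^ (l.length + m.length) * (m.map fun i : ℕ => H K (i : ℤ)).prod := by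
  induction l using coarsenings.induct with
  | case1 => simp [coarsenings, ribbonList]
  | case2 a => simp [coarsenings, ribbonList]
  | case3 a b l ih1 ih2 =>
    have hb : 0 < b := hl b (by simp)
    have ih1 := ih1 fun i hi => hl i (by simp_all)
    have ih2 := ih2 fun i hi => by
      rcases List.mem_cons.1 hi with rfl | hi
      · omega
      · exact hl i (by simp [hi])
    rw [coarsenings, Finset.sum_union, Finset.sum_image (fun _ _ _ _ h => List.tail_eq_of_cons_eq h)]
    · simp only [List.map_cons, ribbonList] at ih1 ih2 ⊢
      push_cast at ih2
      rw [ih1, ih2, sub_eq_add_neg, Finset.mul_sum, ← Finset.sum_neg_distrib]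
      congr 1
      · refine Finset.sum_congr rfl fun m _ => ?_
        rw [List.prod_cons, ← mul_assoc, ← mul_assoc,
          ((Commute.neg_one_right (H K a)).pow_right _).eq]
        congr 2
        simp only [List.length_cons]
        rw [show l.length + 1 + 1 + (m.length + 1) = l.length + 1 + m.length + 2 by ring, pow_add _ _ 2]
        simp
      · refine Finset.sum_congr rfl fun m _ => ?_
        simp only [List.length_cons]
        rw [show l.length + 1 + 1 + m.length = l.length + 1 + m.length + 1 by ring, pow_succ]
        simp
    -- The first entry is `a` in one family and at least `a + b` in the other, and `b` is positive.
    · rw [Finset.disjoint_left]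
      intro m h1 h2
      obtain ⟨m', -, rfl⟩ := Finset.mem_image.1 h1
      obtain ⟨c, m'', h, hc⟩ := head_of_mem_coarsenings h2
      have := List.head_eq_of_cons_eq h
      omega

theorem ribbonComp_eq_ribbonList {n : ℕ} (α : Composition n) :
    ribbonComp K α = ribbonList K (α.blocks.map fun i : ℕ => (i : ℤ)) := by
  classical
  rw [ribbonList_eq_sum _ fun i hi => α.blocks_pos hi, ribbonComp]
  refine Finset.sum_bij (fun β _ => β.blocks) ?_ ?_ ?_ ?_
  · intro β hβ
    exact (coarsens_iff β α).1 (Finset.mem_filter.1 hβ).2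
  · intro β _ γ _ h
    exact Composition.ext h
  · intro m hm
    refine ⟨⟨m, fun {i} hi => pos_of_mem_coarsenings hm (fun i hi => α.blocks_pos hi) i hi,
      (sum_of_mem_coarsenings hm).trans α.blocks_sum⟩, ?_, rfl⟩
    rw [Finset.mem_filter, coarsens_iff]
    exact ⟨Finset.mem_univ _, hm⟩
  · intro β hβ
    have h : β.length ≤ α.length :=
      length_of_mem_coarsenings ((coarsens_iff β α).1 (Finset.mem_filter.1 hβ).2)
    change _ = (-1 : NSym K) ^ (α.length + β.length) * HComp K β
    -- The sum and the truncated difference of the lengths have the same parity.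
    rw [show α.length + β.length = α.length - β.length + 2 * β.length by omega,
      pow_add, pow_mul]
    simp

theorem ribbon_of_pos {k : ℕ} {b : Fin k → ℤ} (hb : ∀ i, 0 < b i) :
    ribbon K b = ribbonList K (List.ofFn b) := by
  rw [ribbon, dif_pos hb, ribbonComp_eq_ribbonList]
  congr 1
  rw [compOfPos, List.map_ofFn]
  congr 1
  funext i
  exact Int.toNat_of_nonneg (hb i).le

/-- The recursion expands on the left, so induction carries the rule to the right end. No positivity
is needed, which allows `b = 0` and `b < 0` later. -/
theorem ribbonList_append_mul (l : List ℤ) (a b : ℤ) :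
    ribbonList K (l ++ [a]) * H K b =
      ribbonList K (l ++ [a, b]) + ribbonList K (l ++ [a + b]) := by
  induction l using ribbonList.induct with
  | case1 => simp [ribbonList]
  | case2 x => simp [ribbonList, sub_mul, mul_sub, mul_assoc, add_assoc]; abel
  | case3 x y l ih1 ih2 =>
    simp only [List.cons_append, ribbonList] at ih1 ih2 ⊢
    rw [sub_mul, mul_assoc, ih1, ih2, mul_add]
    abel

/-! ### The operators `F_{1^i}^⊥` -/

theorem H_zero : H K 0 = 1 := by simp [H]

theorem H_of_neg {a : ℤ} (ha : a < 0) : H K a = 0 := by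
  rw [H, dif_neg (by omega), if_neg (by omega)]

/-- The composition `1^i` has no proper refinement: a refinement has at least `i` parts, and only
`1^i` has that many. -/
theorem fundamentalQSym_ones (i : ℕ) :
    fundamentalQSym K (Composition.ones i) = monomialQSym K (Composition.ones i) := by
  classical
  rw [fundamentalQSym]
  refine Finset.sum_eq_single_of_mem _ ?_ ?_
  · rw [Finset.mem_filter, coarsens_iff, mem_coarsenings]
    refine ⟨Finset.mem_univ _, (Composition.ones i).blocks.map fun a => [a], ?_, ?_, ?_⟩
    · simp
    · induction (Composition.ones i).blocks <;> simp_all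
    · simp
  · intro β hβ hne
    refine absurd ?_ hne
    rw [Composition.eq_ones_iff_le_length]
    have h := length_of_mem_coarsenings ((coarsens_iff _ _).1 (Finset.mem_filter.1 hβ).2)
    simpa [Composition.blocks_length] using h

theorem prod_filter_of_eq_one {M ι : Type*} [Monoid M] (l : List ι) (f : ι → M) (p : ι → Prop)
    [DecidablePred p] (h : ∀ i ∈ l, ¬ p i → f i = 1) :
    ((l.filter p).map f).prod = (l.map f).prod := by
  induction l with
  | nil => simp
  | cons a l ih =>
    have ih := ih fun i hi => h i (by simp [hi])
    by_cases ha : p a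
    · simp [ha, ih]
    · simp [ha, ih, h a (by simp) ha]

/-- Zero exponents contribute `H_0 = 1`, so the composition can be read off an exponent vector
without deleting its zeros. -/
theorem HComp_eq_of_hasShape {n N : ℕ} {α : Composition n} {e : ℕ →₀ ℕ} (h : HasShape α e)
    (he : ∀ j, N ≤ j → e j = 0) :
    HComp K α = (List.ofFn fun j : Fin N => H K (e j : ℤ)).prod := by
  have hb : (e.support.sort (· ≤ ·)).map e = α.blocks := by
    obtain ⟨j, hj, rfl⟩ := h
    rw [sort_map_expo hj (blocksFun_pos α), α.ofFn_blocksFun]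
  have hs : e.support.sort (· ≤ ·) = (List.range N).filter fun j => e j ≠ 0 := by
    have : e.support = ((List.range N).filter fun j => e j ≠ 0).toFinset := by
      ext j
      simp only [Finsupp.mem_support_iff, List.mem_toFinset, List.mem_filter, List.mem_range,
        decide_eq_true_eq]
      exact ⟨fun hj => ⟨not_le.1 fun hN => hj (he j hN), hj⟩, fun hj => hj.2⟩
    rw [this]
    refine (List.toFinset_sort (· ≤ ·) (List.nodup_range.filter _)).2 ?_
    exact (List.pairwise_le_range).filter _
  rw [HComp, ← hb, hs, List.map_map, prod_filter_of_eq_one, List.ofFn_eq_map,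
    ← List.map_coe_finRange_eq_range, List.map_map]
  · rfl
  · intro i _ hi
    simp only [ne_eq, not_not] at hi
    simp [hi, H_zero]

theorem hasShape_ones_iff (i : ℕ) (p : ℕ →₀ ℕ) :
    HasShape (Composition.ones i) p ↔
      ∃ T : Finset ℕ, T.card = i ∧ p = ∑ j ∈ T, Finsupp.single j 1 := by
  constructor
  · rintro ⟨j, hj, rfl⟩
    refine ⟨Finset.univ.image j, ?_, ?_⟩
    · rw [Finset.card_image_of_injective _ hj.injective]
      simp
    · rw [Finset.sum_image fun _ _ _ _ h => hj.injective h]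
      simp [expo]
  · rintro ⟨T, rfl, rfl⟩
    refine ⟨fun x => T.orderEmbOfFin rfl (Fin.cast (by simp) x), ?_, ?_⟩
    · intro a b hab
      exact (T.orderEmbOfFin rfl).strictMono (by simpa using hab)
    · simp only [expo, Composition.ones_blocksFun]
      rw [← Finset.sum_coe_sort T]
      refine (Fintype.sum_equiv ((finCongr (by simp)).trans (T.orderIsoOfFin rfl).toEquiv) _ _ ?_).symm
      intro x
      rfl

theorem sum_hasShape_smul_HComp {N d : ℕ} {e : ℕ →₀ ℕ} (he : ∀ j, N ≤ j → e j = 0)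
    (hd : e.degree ≤ d) :
    ∑ n ∈ range (d + 1), ∑ α : Composition n,
      MvPowerSeries.coeff e (monomialQSym K α) • HComp K α =
      (List.ofFn fun j : Fin N => H K (e j : ℤ)).prod := by
  classical
  obtain ⟨α, hα⟩ := exists_hasShape e
  rw [Finset.sum_eq_single_of_mem e.degree (by simpa [Nat.lt_succ_iff] using hd),
    Finset.sum_eq_single_of_mem α (Finset.mem_univ _)]
  · rw [coeff_monomialQSym, if_pos hα, one_smul, HComp_eq_of_hasShape hα he]
  · intro β _ hβ
    rw [coeff_monomialQSym, if_neg, zero_smul]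
    exact fun h => hβ (h.unique hα)
  · intro n _ hn
    refine Finset.sum_eq_zero fun β _ => ?_
    rw [coeff_monomialQSym, if_neg, zero_smul]
    exact fun h => hn h.degree_eq.symm

/-- `F_{1^i}^⊥` lowers `i` of the factors of a product of generators. -/
theorem perp_ones_HComp {n : ℕ} (γ : Composition n) (i : ℕ) :
    perp (fundamentalQSym K (Composition.ones i)) (HComp K γ) =
      ∑ T : Finset (Fin γ.length) with T.card = i,
        (List.ofFn fun j => H K ((γ.blocksFun j : ℤ) - if j ∈ T then 1 else 0)).prod := by
  classical
  set e := expo (fun i : Fin γ.length => (i : ℕ)) γ.blocksFun with he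
  have hej : ∀ j : Fin γ.length, e j = γ.blocksFun j := by
    intro j
    simp [he, expo, Finsupp.finsetSum_apply, Finsupp.single_apply, Fin.val_inj]
  have hev : ∀ j, γ.length ≤ j → e j = 0 := by
    intro j hj
    simp only [he, expo, Finsupp.finsetSum_apply]
    refine Finset.sum_eq_zero fun x _ => ?_
    rw [Finsupp.single_apply, if_neg]
    exact (x.2.trans_le hj).ne
  have hed : e.degree = n := by rw [he, degree_expo, γ.sum_blocksFun]
  have hn : wordSize (compWord γ) = n := by rw [wordSize, compWord_map, γ.blocks_sum]
  have hpT : ∀ (T : Finset (Fin γ.length)) (j : Fin γ.length),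
      (∑ x ∈ T, Finsupp.single (x : ℕ) 1 : ℕ →₀ ℕ) j = if j ∈ T then 1 else 0 := by
    intro T j
    simp [Finsupp.finsetSum_apply, Finsupp.single_apply, Fin.val_inj]
  have hle : ∀ T : Finset (Fin γ.length), (∑ x ∈ T, Finsupp.single (x : ℕ) 1 : ℕ →₀ ℕ) ≤ e := by
    intro T
    rw [he, expo]
    refine le_trans (Finset.sum_le_sum fun x _ => ?_)
      (Finset.sum_le_sum_of_subset (Finset.subset_univ T))
    simp
  conv_lhs => rw [HComp_eq_wordBasis, perp_wordBasis, ← HComp_eq_wordBasis, hn]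
  simp only [pairing_HComp, fundamentalQSym_ones, MvPowerSeries.coeff_mul, ← he, Finset.sum_smul,
    mul_smul]
  have hswap : ∀ m ∈ range (n + 1), ∑ α : Composition m, ∑ x ∈ Finset.HasAntidiagonal.antidiagonal e,
      MvPowerSeries.coeff x.1 (monomialQSym K (Composition.ones i)) •
        MvPowerSeries.coeff x.2 (monomialQSym K α) • HComp K α =
      ∑ x ∈ Finset.HasAntidiagonal.antidiagonal e,
      MvPowerSeries.coeff x.1 (monomialQSym K (Composition.ones i)) • ∑ α : Composition m,
        MvPowerSeries.coeff x.2 (monomialQSym K α) • HComp K α := by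
    intro m _
    rw [Finset.sum_comm]
    simp only [Finset.smul_sum]
  rw [Finset.sum_congr rfl hswap, Finset.sum_comm]
  simp only [← Finset.smul_sum]
  have hinner : ∀ x ∈ Finset.HasAntidiagonal.antidiagonal e,
      MvPowerSeries.coeff x.1 (monomialQSym K (Composition.ones i)) •
        ∑ m ∈ range (n + 1), ∑ α : Composition m,
          MvPowerSeries.coeff x.2 (monomialQSym K α) • HComp K α =
      if HasShape (Composition.ones i) x.1 then
        (List.ofFn fun j : Fin γ.length => H K (x.2 j : ℤ)).prod else 0 := by
    intro x hx
    have hx := Finset.HasAntidiagonal.mem_antidiagonal.1 hx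
    rw [sum_hasShape_smul_HComp (N := γ.length), coeff_monomialQSym]
    · split_ifs <;> simp
    · intro j hj
      have := DFunLike.congr_fun hx j
      rw [hev j hj, Finsupp.add_apply] at this
      omega
    · rw [← hed, ← hx, map_add]
      omega
  rw [Finset.sum_congr rfl hinner, ← Finset.sum_filter]
  -- A splitting of `e` whose first term has shape `1^i` is the choice of the `i`-set on which that
  -- term equals one. All parts of `γ` are positive, so every such set is allowed.
  symm
  refine Finset.sum_bij (fun T _ => (∑ x ∈ T, Finsupp.single (x : ℕ) 1,
    e - ∑ x ∈ T, Finsupp.single (x : ℕ) 1)) ?_ ?_ ?_ ?_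
  · intro T hT
    rw [Finset.mem_filter, Finset.HasAntidiagonal.mem_antidiagonal, hasShape_ones_iff]
    refine ⟨add_tsub_cancel_of_le (hle T), T.map Fin.valEmbedding, ?_, ?_⟩
    · rw [Finset.card_map]
      exact (Finset.mem_filter.1 hT).2
    · rw [Finset.sum_map]
      rfl
  · intro S _ T _ h
    ext j
    have h := DFunLike.congr_fun (Prod.ext_iff.1 h).1 (j : ℕ)
    simp only [hpT] at h
    by_cases h1 : j ∈ S <;> by_cases h2 : j ∈ T <;> simp_all
  · rintro ⟨p, q⟩ hpq
    rw [Finset.mem_filter, Finset.HasAntidiagonal.mem_antidiagonal, hasShape_ones_iff] at hpq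
    obtain ⟨hpq, S, hS, hp⟩ := hpq
    simp only at hpq hp
    have hlt : ∀ j ∈ S, j < γ.length := by
      intro j hj
      by_contra hne
      have h1 := DFunLike.congr_fun hpq j
      rw [hev j (not_lt.1 hne), Finsupp.add_apply, hp] at h1
      simp [Finsupp.finsetSum_apply, Finsupp.single_apply, hj] at h1
    have hmap : (S.attachFin hlt).map Fin.valEmbedding = S := Finset.map_valEmbedding_attachFin hlt
    have hsum : ∑ x ∈ S.attachFin hlt, Finsupp.single (x : ℕ) 1 = p := by
      rw [hp]
      conv_rhs => rw [← hmap, Finset.sum_map]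
      rfl
    refine ⟨S.attachFin hlt, ?_, ?_⟩
    · simp [hS]
    · rw [hsum, ← hpq, add_tsub_cancel_left]
  · intro T _
    congr 2
    funext j
    congr 1
    have h1 := hle T j
    rw [Finsupp.tsub_apply, Nat.cast_sub h1, hpT, hej]
    split_ifs <;> simp

/-- The algebra map `H_n ↦ H_n + H_{n-1} X`, the generating function of the `F_{1^i}^⊥`. -/
def lowering (K : Type*) [Field K] : NSym K →ₐ[K] Polynomial (NSym K) :=
  FreeAlgebra.lift K fun n : ℕ+ =>
    Polynomial.monomial 0 (H K (n : ℕ)) + Polynomial.monomial 1 (H K ((n : ℕ) - 1))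

theorem lowering_H (a : ℤ) :
    lowering K (H K a) = Polynomial.monomial 0 (H K a) + Polynomial.monomial 1 (H K (a - 1)) := by
  rcases lt_trichotomy a 0 with h | rfl | h
  · simp [H_of_neg h, H_of_neg (show a - 1 < 0 by omega)]
  · rw [H_of_neg (show (0 : ℤ) - 1 < 0 by omega)]
    simp [H_zero]
  · lift a to ℕ using h.le
    have h : 0 < a := by omega
    obtain ⟨n, rfl⟩ : ∃ n : ℕ+, (n : ℕ) = a := ⟨⟨a, h⟩, rfl⟩
    conv_lhs => rw [H_coe]
    rw [lowering, FreeAlgebra.lift_ι_apply]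

theorem prod_ofFn_monomial {A : Type*} [Semiring A] {k : ℕ} (d : Fin k → ℕ) (v : Fin k → A) :
    (List.ofFn fun j => Polynomial.monomial (d j) (v j)).prod =
      Polynomial.monomial (∑ j, d j) (List.ofFn v).prod := by
  induction k with
  | zero => simp
  | succ k ih =>
    rw [List.ofFn_succ, List.prod_cons, ih, Polynomial.monomial_mul_monomial, Fin.sum_univ_succ,
      List.ofFn_succ, List.prod_cons]

theorem lowering_prod {k : ℕ} (b : Fin k → ℤ) :
    lowering K (List.ofFn fun j => H K (b j)).prod = ∑ T : Finset (Fin k),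
      Polynomial.monomial T.card (List.ofFn fun j => H K (b j - if j ∈ T then 1 else 0)).prod := by
  rw [map_list_prod, List.map_ofFn]
  -- Multilinearity of the ordered product expands it over subsets although the factors do not
  -- commute.
  have h := (MultilinearMap.mkPiAlgebraFin K k (Polynomial (NSym K))).map_add_univ
    (fun j => Polynomial.monomial 1 (H K (b j - 1))) (fun j => Polynomial.monomial 0 (H K (b j)))
  simp only [MultilinearMap.mkPiAlgebraFin_apply] at h
  rw [show (lowering K ∘ fun j => H K (b j)) = (fun j => Polynomial.monomial 1 (H K (b j - 1))) +
    (fun j => Polynomial.monomial 0 (H K (b j))) by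
      funext j; simp only [Function.comp_apply, lowering_H, Pi.add_apply, add_comm], h]
  refine Finset.sum_congr rfl fun T _ => ?_
  have : T.piecewise (fun j => Polynomial.monomial 1 (H K (b j - 1)))
      (fun j => Polynomial.monomial 0 (H K (b j))) = fun j =>
      Polynomial.monomial (if j ∈ T then 1 else 0) (H K (b j - if j ∈ T then 1 else 0)) := by
    funext j
    by_cases hj : j ∈ T <;> simp [hj]
  rw [this, prod_ofFn_monomial]
  simp

/-- `perp_ones_HComp` concerns positive indices only. The algebra map `lowering` obeys one formula
on `H_a` for every integer `a`, so this identity extends the lowering rule to the arbitrary indices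
met when Bernstein operators are iterated. -/
theorem perp_ones_eq_coeff (i : ℕ) (h : NSym K) :
    perp (fundamentalQSym K (Composition.ones i)) h = (lowering K h).coeff i := by
  induction (wordBasis K).mem_span h using Submodule.span_induction with
  | zero => simp
  | add x y _ _ hx hy => simp [hx, hy]
  | smul c x _ hx => simp [hx]
  | mem x hx =>
    obtain ⟨w, rfl⟩ := hx
    rw [wordBasis_eq_HComp, perp_ones_HComp]
    have : HComp K (wordComp w) =
        (List.ofFn fun j => H K ((wordComp w).blocksFun j : ℤ)).prod := by
      rw [HComp, ← (wordComp w).ofFn_blocksFun, List.map_ofFn]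
      rfl
    rw [this, lowering_prod, Polynomial.finsetSum_coeff, Finset.sum_filter]
    simp only [Polynomial.coeff_monomial]

/-- The noncommutative Bernstein operator on a product of generators. -/
theorem bernstein_prod {k : ℕ} (m : ℤ) (b : Fin k → ℤ) :
    bernstein K m (List.ofFn fun j => H K (b j)).prod = ∑ T : Finset (Fin k),
      (-1 : NSym K) ^ T.card * (H K (m + T.card) *
        (List.ofFn fun j => H K (b j - if j ∈ T then 1 else 0)).prod) := by
  change ∑ᶠ i : ℕ, (-1 : NSym K) ^ i * H K (m + i) * perp (fundamentalQSym K
    (Composition.ones i)) _ = _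
  simp only [perp_ones_eq_coeff, lowering_prod, Polynomial.finsetSum_coeff,
    Polynomial.coeff_monomial]
  -- At most `k` factors can be lowered.
  rw [finsum_eq_sum_of_support_subset (s := range (k + 1))]
  · simp only [Finset.mul_sum, mul_ite, mul_zero]
    rw [Finset.sum_comm]
    refine Finset.sum_congr rfl fun T _ => ?_
    rw [Finset.sum_ite_eq, if_pos, mul_assoc]
    rw [Finset.mem_range, Nat.lt_succ_iff]
    exact T.card_le_univ.trans (by simp)
  · intro i hi
    rw [Finset.mem_coe, Finset.mem_range]
    by_contra hne
    refine hi ?_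
    change _ * ∑ T : Finset (Fin k), _ = _
    rw [Finset.sum_eq_zero, mul_zero]
    intro T _
    rw [if_neg]
    have := T.card_le_univ
    simp at this
    omega

/-! ### The Jacobi-Trudi formula -/

/-- The linear map `x^b ↦ H_{b_1} ⋯ H_{b_k}` on Laurent polynomials. -/
def ofLaurent (K : Type*) [Field K] (k : ℕ) :
    AddMonoidAlgebra K (Fin k → ℤ) →ₗ[K] NSym K :=
  (AddMonoidAlgebra.basis (Fin k → ℤ) K).constr K fun b => (List.ofFn fun j => H K (b j)).prod

theorem ofLaurent_single {k : ℕ} (b : Fin k → ℤ) (c : K) :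
    ofLaurent K k (AddMonoidAlgebra.single b c) = c • (List.ofFn fun j => H K (b j)).prod := by
  have h := (AddMonoidAlgebra.basis (Fin k → ℤ) K).constr_basis K
    (fun b => (List.ofFn fun j => H K (b j)).prod) b
  rw [AddMonoidAlgebra.basis_apply] at h
  rw [show AddMonoidAlgebra.single b c = c • AddMonoidAlgebra.single b 1 by simp, map_smul]
  exact congrArg _ h

/-- The inclusion of Laurent polynomials in `k` variables as those in `x_1, …, x_k` among
`x_0, …, x_k`. -/
def shiftVars (K : Type*) [Field K] (k : ℕ) :
    AddMonoidAlgebra K (Fin k → ℤ) →+* AddMonoidAlgebra K (Fin (k + 1) → ℤ) :=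
  AddMonoidAlgebra.mapDomainRingHom K
    { toFun := fun b => Fin.cons 0 b
      map_zero' := by funext i; refine Fin.cases ?_ (fun i => ?_) i <;> simp
      map_add' := fun a b => by funext i; refine Fin.cases ?_ (fun i => ?_) i <;> simp }

theorem shiftVars_single {k : ℕ} (b : Fin k → ℤ) (c : K) :
    shiftVars K k (AddMonoidAlgebra.single b c) =
      AddMonoidAlgebra.single (Fin.cons 0 b : Fin (k + 1) → ℤ) c :=
  AddMonoidAlgebra.mapDomain_single

/-- Choosing `-x_0/x_j` in the `j`-th factor lowers the `j`-th generator, raises the new leading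
index and contributes a sign, so expanding the product reproduces the sum over subsets in
`bernstein_prod`. -/
theorem bernstein_ofLaurent {k : ℕ} (m : ℤ) (g : AddMonoidAlgebra K (Fin k → ℤ)) :
    bernstein K m (ofLaurent K k g) = ofLaurent K (k + 1)
      (AddMonoidAlgebra.single (Fin.cons m 0) 1 *
        (∏ j : Fin k, (1 + AddMonoidAlgebra.single
          (Pi.single 0 1 - Pi.single j.succ 1 : Fin (k + 1) → ℤ) (-1))) * shiftVars K k g) := by
  induction g using AddMonoidAlgebra.induction_linear with
  | zero => simp
  | add x y hx hy => simp only [map_add, mul_add, hx, hy]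
  | single b c =>
    rw [ofLaurent_single, map_smul, bernstein_prod, shiftVars_single, Finset.prod_one_add,
      Finset.powerset_univ, Finset.mul_sum, Finset.sum_mul, map_sum, Finset.smul_sum]
    refine Finset.sum_congr rfl fun T _ => ?_
    rw [AddMonoidAlgebra.prod_single, AddMonoidAlgebra.single_mul_single,
      AddMonoidAlgebra.single_mul_single, ofLaurent_single, List.ofFn_succ, List.prod_cons,
      Finset.prod_const, one_mul, mul_comm, mul_smul]
    congr 1
    rw [Algebra.smul_def]
    congr 1
    · simp
    · congr 2
      · simp [Finset.sum_apply]
      · congr 1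
        funext j
        congr 1
        simp [Finset.sum_apply, Pi.single_apply, Fin.succ_inj, sub_eq_add_neg, add_comm]

/-- `∑_σ ε(σ) x^{σ - id}`. -/
def skewVandermonde (K : Type*) [Field K] (k : ℕ) : AddMonoidAlgebra K (Fin k → ℤ) :=
  ∑ σ : Equiv.Perm (Fin k), ((Equiv.Perm.sign σ : ℤˣ) : ℤ) •
    AddMonoidAlgebra.single (fun l => ((σ l : ℕ) : ℤ) - ((l : ℕ) : ℤ)) 1

theorem skewVandermonde_eq_prod (k : ℕ) :
    skewVandermonde K k = AddMonoidAlgebra.single (fun l : Fin k => -((l : ℕ) : ℤ)) (1 : K) *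
      ∏ i : Fin k, ∏ j > i, (AddMonoidAlgebra.single (Pi.single j 1 : Fin k → ℤ) (1 : K) -
        AddMonoidAlgebra.single (Pi.single i 1 : Fin k → ℤ) (1 : K)) := by
  rw [← Matrix.det_vandermonde (fun i : Fin k =>
      AddMonoidAlgebra.single (Pi.single i 1 : Fin k → ℤ) (1 : K)),
    ← Matrix.det_transpose, Matrix.det_apply, Finset.mul_sum, skewVandermonde]
  refine Finset.sum_congr rfl fun σ _ => ?_
  simp only [Matrix.transpose_apply, Matrix.vandermonde_apply, AddMonoidAlgebra.single_pow,
    one_pow, AddMonoidAlgebra.prod_single, Finset.prod_const_one]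
  rw [Units.smul_def, mul_smul_comm, AddMonoidAlgebra.single_mul_single, one_mul]
  congr 2
  funext l
  simp [Finset.sum_apply, Pi.single_apply, sub_eq_add_neg, add_comm]

/-- Write `x_j - x_0 = x_j (1 - x_0/x_j)` in the Vandermonde product. The extracted `x_j` with `j ≥
1` account for the change of exponent from `-(l + 1)` to `-l` when the variables are shifted. -/
theorem skewVandermonde_succ (k : ℕ) :
    skewVandermonde K (k + 1) = (∏ j : Fin k, (1 + AddMonoidAlgebra.single
          (Pi.single 0 1 - Pi.single j.succ 1 : Fin (k + 1) → ℤ) (-1))) *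
      shiftVars K k (skewVandermonde K k) := by
  have h1 : ∀ j : Fin k, AddMonoidAlgebra.single (Pi.single j.succ 1 : Fin (k + 1) → ℤ) (1 : K) -
      AddMonoidAlgebra.single (Pi.single 0 1) 1 =
      AddMonoidAlgebra.single (Pi.single j.succ 1 : Fin (k + 1) → ℤ) 1 *
      (1 + AddMonoidAlgebra.single (Pi.single 0 1 - Pi.single j.succ 1) (-1)) := by
    intro j
    rw [mul_add, mul_one, AddMonoidAlgebra.single_mul_single, one_mul, add_sub_cancel,
      sub_eq_add_neg, AddMonoidAlgebra.single_neg]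
  have h2 : ∀ i : Fin k, (Fin.cons 0 (Pi.single i 1 : Fin k → ℤ) : Fin (k + 1) → ℤ) =
      Pi.single i.succ 1 := by
    intro i
    funext j
    refine Fin.cases ?_ (fun j => ?_) j <;> simp [Pi.single_apply, Fin.succ_inj]
  rw [skewVandermonde_eq_prod, skewVandermonde_eq_prod, Fin.prod_univ_succ, map_mul,
    shiftVars_single, map_prod, Fin.prod_Ioi_zero]
  simp only [map_prod, map_sub, shiftVars_single, Fin.prod_Ioi_succ, h1, h2,
    Finset.prod_mul_distrib, AddMonoidAlgebra.prod_single, Finset.prod_const_one]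
  rw [← mul_assoc, ← mul_assoc, ← mul_assoc, AddMonoidAlgebra.single_mul_single, one_mul,
    mul_comm (AddMonoidAlgebra.single _ _)]
  congr 4
  funext l
  refine Fin.cases ?_ (fun l => ?_) l
  · simp [Finset.sum_apply]
  · simp [Finset.sum_apply, Pi.single_apply, Fin.succ_inj]

theorem immaculate_eq_ofLaurent {k : ℕ} (a : Fin k → ℤ) :
    immaculate K (List.ofFn a) =
      ofLaurent K k (AddMonoidAlgebra.single a 1 * skewVandermonde K k) := by
  induction k with
  | zero =>
    rw [skewVandermonde, Fintype.sum_subsingleton _ 1]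
    simp [immaculate, AddMonoidAlgebra.single_mul_single, ofLaurent_single]
  | succ k ih =>
    rw [List.ofFn_succ]
    change bernstein K (a 0) (immaculate K (List.ofFn fun i => a i.succ)) = _
    rw [ih, bernstein_ofLaurent, skewVandermonde_succ, map_mul (shiftVars K k), shiftVars_single]
    congr 1
    have : AddMonoidAlgebra.single a (1 : K) =
        AddMonoidAlgebra.single (Fin.cons (a 0) 0 : Fin (k + 1) → ℤ) 1 *
        AddMonoidAlgebra.single (Fin.cons 0 (fun i => a i.succ) : Fin (k + 1) → ℤ) 1 := by
      rw [AddMonoidAlgebra.single_mul_single, one_mul]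
      congr 1
      funext l
      refine Fin.cases ?_ (fun l => ?_) l <;> simp
    rw [this]
    ring

/-- The Jacobi-Trudi formula for immaculate functions. -/
theorem immaculate_eq_sum_perm {k : ℕ} (a : Fin k → ℤ) :
    immaculate K (List.ofFn a) =
      ∑ σ : Equiv.Perm (Fin k), ((Equiv.Perm.sign σ : ℤˣ) : ℤ) •
        (List.ofFn fun l => H K (a l - ((l : ℕ) : ℤ) + ((σ l : ℕ) : ℤ))).prod := by
  rw [immaculate_eq_ofLaurent, skewVandermonde, Finset.mul_sum, map_sum]
  refine Finset.sum_congr rfl fun σ _ => ?_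
  rw [mul_smul_comm, map_zsmul, AddMonoidAlgebra.single_mul_single, ofLaurent_single, one_mul,
    one_smul]
  congr 3
  funext l
  congr 1
  simp only [Pi.add_apply]
  ring

/-! ### Interpolating between products of generators and ribbons -/

/-- The ribbon of `b_0, …, b_{t-1}` times `H_{b_t} ⋯ H_{b_{k-1}}`, or zero if one of
`b_0, …, b_{t-1}` is not positive. -/
def partialRibbon (K : Type*) [Field K] (k t : ℕ) (b : ℕ → ℤ) : NSym K :=
  if ∀ i < t, 0 < b i then
    ribbonList K ((List.range t).map b) * ((List.range' t (k - t)).map fun i => H K (b i)).prod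
  else 0

/-- The difference of two consecutive partial ribbons. -/
def mergedRibbon (K : Type*) [Field K] (k t : ℕ) (b : ℕ → ℤ) : NSym K :=
  if (∀ i < t, 0 < b i) ∧ 0 < b t ∧ 0 ≤ b (t + 1) then
    ribbonList K ((List.range t).map b ++ [b t + b (t + 1)]) *
      ((List.range' (t + 2) (k - (t + 2))).map fun i => H K (b i)).prod
  else 0

/-- For `b (t + 1) > 0` this is the multiplication rule. For `b (t + 1) = 0` the longer ribbon is
zero by convention and `H_0 = 1` makes the left side the merged term. For `b (t + 1) < 0` all three
vanish. Hence the strict and weak inequalities in `mergedRibbon`. -/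
theorem partialRibbon_succ {k t : ℕ} (ht : t + 2 ≤ k) (b : ℕ → ℤ) :
    partialRibbon K k (t + 1) b = partialRibbon K k (t + 2) b + mergedRibbon K k t b := by
  have e1 : (∀ i < t + 1, 0 < b i) ↔ (∀ i < t, 0 < b i) ∧ 0 < b t := Nat.forall_lt_succ_right
  have e2 : (∀ i < t + 2, 0 < b i) ↔ (∀ i < t + 1, 0 < b i) ∧ 0 < b (t + 1) :=
    Nat.forall_lt_succ_right
  have hr : List.range' (t + 1) (k - (t + 1)) =
      (t + 1) :: List.range' (t + 2) (k - (t + 2)) := by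
    rw [show k - (t + 1) = k - (t + 2) + 1 by omega, List.range'_succ]
  have hm := ribbonList_append_mul (K := K) ((List.range t).map b) (b t) (b (t + 1))
  have r1 : (List.range (t + 1)).map b = (List.range t).map b ++ [b t] := by
    simp [List.range_succ]
  have r2 : (List.range (t + 2)).map b = (List.range t).map b ++ [b t, b (t + 1)] := by
    simp [List.range_succ]
  simp only [partialRibbon, mergedRibbon, e2, e1, hr, r1, r2, List.map_cons, List.prod_cons]
  rw [← mul_assoc, hm]
  by_cases hA : ∀ i < t, 0 < b i
  · by_cases hB : 0 < b t
    · simp only [eq_true hA, hB, true_and, if_true]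
      rcases lt_trichotomy (b (t + 1)) 0 with h1 | h1 | h1
      · rw [if_neg (by omega), if_neg (by omega), ← hm, H_of_neg h1]
        simp
      · rw [if_neg (by omega), if_pos h1.ge, ← hm, h1, H_zero]
        simp
      · rw [if_pos h1, if_pos h1.le, add_mul]
    · simp [hB]
  · simp [eq_false hA]

theorem mergedRibbon_congr {k t : ℕ} {b c : ℕ → ℤ} (h : ∀ i, i ≠ t → i ≠ t + 1 → b i = c i)
    (hs : b t + b (t + 1) = c t + c (t + 1))
    (hp : 0 < b t ∧ 0 ≤ b (t + 1) ↔ 0 < c t ∧ 0 ≤ c (t + 1)) :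
    mergedRibbon K k t b = mergedRibbon K k t c := by
  have h1 : (List.range t).map b = (List.range t).map c :=
    List.map_congr_left fun i hi => h i (List.mem_range.1 hi).ne
      ((List.mem_range.1 hi).trans t.lt_succ_self).ne
  have h2 : (List.range' (t + 2) (k - (t + 2))).map (fun i => H K (b i)) =
      (List.range' (t + 2) (k - (t + 2))).map fun i => H K (c i) := by
    refine List.map_congr_left fun i hi => ?_
    have := (List.mem_range'_1.1 hi).1
    rw [h i (by omega) (by omega)]
  have h3 : (∀ i < t, 0 < b i) ↔ ∀ i < t, 0 < c i :=
    forall₂_congr fun i hi => by rw [h i (by omega) (by omega)]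
  simp only [mergedRibbon, h1, h2, hs, h3, hp]

/-- The integer sequence `α_1 - 1 + σ_1, …, α_k - k + σ_k`, extended by zero. -/
def permSeq {k : ℕ} (α : Fin k → ℕ) (σ : Equiv.Perm (Fin k)) (i : ℕ) : ℤ :=
  if h : i < k then (α ⟨i, h⟩ : ℤ) - ((i : ℤ) + 1) + (((σ ⟨i, h⟩ : ℕ) : ℤ) + 1) else 0

/-- The sign-reversing involution exchanges the values of `σ` at the positions `t` and `t + 1`. The
hypotheses on `α` serve to make the sign condition of the merged term invariant under it. -/
theorem sum_mergedRibbon_eq_zero {k J t : ℕ} {α : Fin k → ℕ} (ht : t + 2 ≤ k)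
    (hle : ∀ l : Fin k, (l : ℕ) + 1 ≤ J → (l : ℕ) + 1 ≤ α l)
    (hgt : ∀ l : Fin k, J + 1 ≤ (l : ℕ) + 1 → α l = J) :
    ∑ σ : Equiv.Perm (Fin k), ((Equiv.Perm.sign σ : ℤˣ) : ℤ) •
      mergedRibbon K k t (permSeq α σ) = 0 := by
  have h0 : t < k := by omega
  have h1 : t + 1 < k := by omega
  let s : Equiv.Perm (Fin k) := Equiv.swap ⟨t, h0⟩ ⟨t + 1, h1⟩
  have hne : (⟨t, h0⟩ : Fin k) ≠ ⟨t + 1, h1⟩ := by simp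
  refine Finset.sum_involution (fun σ _ => σ * s) ?_ ?_ (fun σ _ => Finset.mem_univ _) ?_
  · intro σ _
    have : mergedRibbon K k t (permSeq α (σ * s)) = mergedRibbon K k t (permSeq α σ) := by
      have hs0 : s ⟨t, h0⟩ = ⟨t + 1, h1⟩ := Equiv.swap_apply_left _ _
      have hs1 : s ⟨t + 1, h1⟩ = ⟨t, h0⟩ := Equiv.swap_apply_right _ _
      apply mergedRibbon_congr
      · intro i hi hi'
        rw [permSeq, permSeq]
        split_ifs with h
        · rw [Equiv.Perm.mul_apply, Equiv.swap_apply_of_ne_of_ne] <;> simpa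
        · rfl
      · simp only [permSeq, dif_pos h0, dif_pos h1, Equiv.Perm.mul_apply, hs0, hs1]
        ring
      · simp only [permSeq, dif_pos h0, dif_pos h1, Equiv.Perm.mul_apply, hs0, hs1]
        -- Put `ℓ = t + 1`, counting positions and values of `σ` from one. If `ℓ ≤ J`, both
        -- inequalities always hold; for `ℓ = J` the second one does because it is weak and `σ_{J+1}
        -- ≥ 1`. If `ℓ > J`, both parts equal `J` and the inequalities read `σ_ℓ > ℓ - J` and
        -- `σ_{ℓ+1} > ℓ - J`, a symmetric condition.
        have a1 := hle ⟨t, h0⟩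
        have a2 := hle ⟨t + 1, h1⟩
        have a3 := hgt ⟨t, h0⟩
        have a4 := hgt ⟨t + 1, h1⟩
        simp only at a1 a2 a3 a4
        push_cast
        omega
    rw [this, Equiv.Perm.sign_mul, Equiv.Perm.sign_swap hne]
    simp
  · intro σ _ _ h
    exact hne (Equiv.swap_eq_one_iff.1 (mul_eq_left.1 h))
  · intro σ _
    rw [mul_assoc, Equiv.swap_mul_self, mul_one]

theorem sum_partialRibbon {k J t : ℕ} {α : Fin k → ℕ} (ht : t + 1 ≤ k)
    (hle : ∀ l : Fin k, (l : ℕ) + 1 ≤ J → (l : ℕ) + 1 ≤ α l)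
    (hgt : ∀ l : Fin k, J + 1 ≤ (l : ℕ) + 1 → α l = J) :
    ∑ σ : Equiv.Perm (Fin k), ((Equiv.Perm.sign σ : ℤˣ) : ℤ) •
      partialRibbon K k (t + 1) (permSeq α σ) =
    ∑ σ : Equiv.Perm (Fin k), ((Equiv.Perm.sign σ : ℤˣ) : ℤ) •
      partialRibbon K k 1 (permSeq α σ) := by
  induction t with
  | zero => rfl
  | succ t ih =>
    rw [← ih (by omega)]
    simp only [partialRibbon_succ ht, smul_add, Finset.sum_add_distrib,
      sum_mergedRibbon_eq_zero ht hle hgt, add_zero]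

theorem map_range_eq_ofFn {β : Type*} {k : ℕ} (b : ℕ → β) :
    (List.range k).map b = List.ofFn fun i : Fin k => b i := by
  rw [List.ofFn_eq_map, ← List.map_coe_finRange_eq_range, List.map_map]
  rfl

theorem partialRibbon_one {k : ℕ} (hk : 0 < k) {b : ℕ → ℤ} (hb : 0 < b 0) :
    partialRibbon K k 1 b = (List.ofFn fun i : Fin k => H K (b i)).prod := by
  rw [← map_range_eq_ofFn fun i => H K (b i), partialRibbon, if_pos (by simpa using hb)]
  obtain ⟨k, rfl⟩ := Nat.exists_eq_succ_of_ne_zero hk.ne'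
  rw [List.range_eq_range' (n := k + 1), List.range'_succ]
  simp [ribbonList]

theorem partialRibbon_self {k : ℕ} (b : ℕ → ℤ) :
    partialRibbon K k k b = ribbon K fun i : Fin k => b i := by
  by_cases h : ∀ i < k, 0 < b i
  · rw [ribbon_of_pos fun i : Fin k => h i i.2, partialRibbon, if_pos h, map_range_eq_ofFn]
    simp
  · rw [partialRibbon, if_neg h, ribbon, dif_neg]
    exact fun h' => h fun i hi => h' ⟨i, hi⟩

theorem permSeq_coe {k : ℕ} (α : Fin k → ℕ) (σ : Equiv.Perm (Fin k)) (l : Fin k) :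
    permSeq α σ l = (α l : ℤ) - (((l : ℕ) : ℤ) + 1) + (((σ l : ℕ) : ℤ) + 1) :=
  dif_pos l.2

end Immaculate

end

theorem theorem6p4 {K : Type*} [Field K] [CharZero K] (k : ℕ) (α : Fin k → ℕ)
    (hα : ∀ l : Fin k, 0 < α l) (J : ℕ) (hJ : 1 ≤ J) (hJk : J ≤ k)
    (hle : ∀ l : Fin k, (l : ℕ) + 1 ≤ J → (l : ℕ) + 1 ≤ α l)
    (hgt : ∀ l : Fin k, J + 1 ≤ (l : ℕ) + 1 → α l = J) :
    Immaculate.immaculate K (List.ofFn fun l => (α l : ℤ)) =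
      ∑ σ : Equiv.Perm (Fin k), ((Equiv.Perm.sign σ : ℤˣ) : ℤ) •
        Immaculate.ribbon K
          (fun l => (α l : ℤ) - (((l : ℕ) : ℤ) + 1) + (((σ l : ℕ) : ℤ) + 1)) := by
  have hk : 0 < k := by omega
  have h := Immaculate.sum_partialRibbon (K := K) (t := k - 1) (by omega) hle hgt
  rw [Nat.sub_add_cancel hk] at h
  simp only [Immaculate.partialRibbon_self, Immaculate.permSeq_coe] at h
  rw [h, Immaculate.immaculate_eq_sum_perm]
  refine Finset.sum_congr rfl fun σ _ => ?_
  rw [Immaculate.partialRibbon_one hk]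
  · simp only [Immaculate.permSeq_coe]
    congr 3
    funext l
    congr 1
    ring
  -- The first entry is `α_1 - 1 + σ_1 ≥ 1`, so converting the first factor into a one-part ribbon
  -- loses nothing.
  · rw [Immaculate.permSeq, dif_pos hk]
    have := hα ⟨0, hk⟩
    push_cast
    omega
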